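/- For $\nu,z\in\mathbb{C}$ let $I_\nu(z)=\sum_{k=0}^\infty \frac{(z/2)^{2k+\nu}}{k!\,\Gamma(k+\nu+1)}$ be the modified Bessel function of the first kind (with the principal branch of the power, and $1/\Gamma=0$ at the poles of $\Gamma$). Let $x>0$, $\tau\in\mathbb{R}$ and $0<\gamma<\tfrac12$, and put $$\Psi_\tau(x)=\frac{\sqrt\pi}{\cosh(\pi\tau)}\,e^{-x/2}\,\mathrm{Re}\left[I_{i\tau}\left(\frac{x}{2}\right)\right].$$ Then $$\Psi_\tau(x)=\frac{1}{2\pi i}\int_{\gamma-i\infty}^{\gamma+i\infty}\frac{\Gamma(s+i\tau)\,\Gamma(s-i\tau)\,\Gamma(1/2-s)}{\Gamma(s)\,\Gamma(1-s)}\,x^{-s}\,ds,$$ where the integral along the vertical line $\mathrm{Re}\,s=\gamma$ converges absolutely. -/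

import Mathlib

/-- The modified Bessel function of the first kind
`I_ν(z) = ∑ₖ (z/2)^(2k+ν) / (k! Γ(k+ν+1))`, with the principal branch of the power. The series
converges absolutely for all `ν` and `z`; at a pole of `Γ` the value `Complex.Gamma = 0` and
division by zero give the usual convention `1/Γ = 0`. -/
noncomputable def besselI (ν z : ℂ) : ℂ :=
  ∑' k : ℕ, (z / 2) ^ (2 * (k : ℂ) + ν) / ((k.factorial : ℂ) * Complex.Gamma ((k : ℂ) + ν + 1))

/-- The kernel `Ψ_τ(x) = (√π / cosh (πτ)) e^(-x/2) Re [I_{iτ}(x/2)]`. -/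
noncomputable def lebedevSkalskayaKernel (τ x : ℝ) : ℝ :=
  Real.sqrt Real.pi / Real.cosh (Real.pi * τ) * Real.exp (-x / 2) *
    (besselI (Complex.I * (τ : ℂ)) ((x : ℂ) / 2)).re

/-- The contour integral `∫_{γ-i∞}^{γ+i∞} f(s) ds` along the upward vertical line `Re s = γ`,
parametrized by `s = γ + i t`, `ds = i dt`. -/
noncomputable def verticalLineIntegral (f : ℂ → ℂ) (γ : ℝ) : ℂ :=
  ∫ t : ℝ, f ((γ : ℂ) + (t : ℂ) * Complex.I) * Complex.I

/-- The integrand `Γ(s+iτ) Γ(s-iτ) Γ(1/2-s) / (Γ(s) Γ(1-s)) x^(-s)`. -/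
noncomputable def mellinBarnesIntegrand (τ x : ℝ) (s : ℂ) : ℂ :=
  Complex.Gamma (s + Complex.I * (τ : ℂ)) * Complex.Gamma (s - Complex.I * (τ : ℂ)) *
      Complex.Gamma (1 / 2 - s) / (Complex.Gamma s * Complex.Gamma (1 - s)) *
    (x : ℂ) ^ (-s)

/-!
The proof is by Mellin inversion. With `a = 1/2 + ν`, Poisson's integral reads
`√π Γ(a) e ^ (-x/2) I_ν(x/2) = x ^ ν ∫₀¹ e ^ (-ux) (u (1 - u)) ^ (a - 1) du`
(`cpow_mul_betaLaplace`). It is obtained by expanding `e ^ (-ux)` around `u = 1/2` and evaluating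
the centred moments of the beta density (`setIntegral_beta_mul_centered_pow_even`).

By Fubini, the Mellin transform of the right-hand side at `s` is `Γ(s + ν) B(1/2 - s, a)`
(`mellin_betaLaplace`). On a vertical line the beta factor is bounded, while `Γ(s + ν)` decays
quadratically, so this transform is integrable (`verticalIntegrable_besselMellin`) and can be
inverted (`integrable_and_integral_besselMellin`); no form of Stirling's formula is needed.

For real `τ` and `x > 0`, `Re I_{iτ}(x/2)` is the mean of `I_{iτ}(x/2)` and `I_{-iτ}(x/2)`. Adding
the two Mellin transforms with the reflection formula for `Γ` produces the factor `cosh(πτ)` and the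
integrand in the statement (`cos_mul_Gamma_quotient`).
-/

open MeasureTheory Set

/-! ### The Mellin transform of a Laplace transform -/

/-- The Mellin transform of the Laplace transform of `g` is `Γ(s) ∫ u ^ (-s) g(u) du`, by Fubini. -/
theorem mellin_laplace {g : ℝ → ℂ} {s : ℂ} (hs : 0 < s.re)
    (hg : AEStronglyMeasurable g (volume.restrict (Ioc 0 1)))
    (hint : IntegrableOn (fun u : ℝ => (u : ℂ) ^ (-s) * g u) (Ioc 0 1)) :
    MellinConvergent (fun x : ℝ => ∫ u in Ioc (0 : ℝ) 1, Complex.exp (-(u * x)) * g u) s ∧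
      mellin (fun x : ℝ => ∫ u in Ioc (0 : ℝ) 1, Complex.exp (-(u * x)) * g u) s =
        Complex.Gamma s * ∫ u in Ioc (0 : ℝ) 1, (u : ℂ) ^ (-s) * g u := by
  have hmeas : AEStronglyMeasurable
      (fun p : ℝ × ℝ => (p.1 : ℂ) ^ (s - 1) * (Complex.exp (-(p.2 * p.1)) * g p.2))
      ((volume.restrict (Ioi 0)).prod (volume.restrict (Ioc 0 1))) := by
    have h1 : Measurable fun p : ℝ × ℝ => (p.1 : ℂ) ^ (s - 1) := by fun_prop
    have h2 : Measurable fun p : ℝ × ℝ => Complex.exp (-(p.2 * p.1)) := by fun_prop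
    exact h1.aestronglyMeasurable.mul (h2.aestronglyMeasurable.mul hg.comp_snd)
  have hnorm : ∀ u : ℝ, 0 < u → ∀ x ∈ Ioi (0 : ℝ),
      ‖(x : ℂ) ^ (s - 1) * (Complex.exp (-(u * x)) * g u)‖ =
        x ^ (s.re - 1) * Real.exp (-(u * x)) * ‖g u‖ := by
    intro u hu x hx
    rw [norm_mul, norm_mul, Complex.norm_cpow_eq_rpow_re_of_pos hx, Complex.norm_exp]
    simp [mul_assoc]
  have hprod : Integrable
      (fun p : ℝ × ℝ => (p.1 : ℂ) ^ (s - 1) * (Complex.exp (-(p.2 * p.1)) * g p.2))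
      ((volume.restrict (Ioi 0)).prod (volume.restrict (Ioc 0 1))) := by
    rw [integrable_prod_iff' hmeas]
    constructor
    · filter_upwards [ae_restrict_mem measurableSet_Ioc] with u hu
      have h0 : IntegrableOn (fun x : ℝ => x ^ (s.re - 1) * Real.exp (-(u * x)) * ‖g u‖)
          (Ioi 0) := by
        have := integrableOn_rpow_mul_exp_neg_mul_rpow (s := s.re - 1) (p := 1) (b := u)
          (by linarith) one_pos hu.1
        simp only [Real.rpow_one, neg_mul] at this
        exact this.mul_const _
      refine Integrable.mono' h0 ?_ ?_
      · have h1 : Measurable fun x : ℝ => (x : ℂ) ^ (s - 1) * (Complex.exp (-(u * x)) * g u) := by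
          fun_prop
        exact h1.aestronglyMeasurable
      · filter_upwards [ae_restrict_mem measurableSet_Ioi] with x hx
        exact (hnorm u hu.1 x hx).le
    · refine (hint.norm.const_mul (Real.Gamma s.re)).congr ?_
      filter_upwards [ae_restrict_mem measurableSet_Ioc] with u hu
      rw [setIntegral_congr_fun measurableSet_Ioi (hnorm u hu.1), integral_mul_const,
        Real.integral_rpow_mul_exp_neg_mul_Ioi hs hu.1, norm_mul,
        Complex.norm_cpow_eq_rpow_re_of_pos hu.1, Complex.neg_re, Real.rpow_neg hu.1.le,
        one_div, Real.inv_rpow hu.1.le]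
      ring
  have hpull : ∀ x : ℝ, (x : ℂ) ^ (s - 1) • ∫ u in Ioc (0 : ℝ) 1, Complex.exp (-(u * x)) * g u =
      ∫ u in Ioc (0 : ℝ) 1, (x : ℂ) ^ (s - 1) * (Complex.exp (-(u * x)) * g u) := fun x => by
    rw [integral_const_mul, smul_eq_mul]
  constructor
  · simp only [MellinConvergent, hpull]
    exact hprod.integral_prod_left
  · simp only [mellin, hpull]
    rw [integral_integral_swap hprod, ← integral_const_mul]
    refine setIntegral_congr_fun measurableSet_Ioc fun u hu => ?_
    simp only [← mul_assoc, integral_mul_const]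
    rw [Complex.integral_cpow_mul_exp_neg_mul_Ioi hs hu.1, one_div,
      Complex.inv_cpow _ _ (by
        rw [Complex.arg_ofReal_of_nonneg hu.1.le]; exact Real.pi_pos.ne), Complex.cpow_neg]
    ring

/-! ### The Laplace transform of the beta density -/

/-- The Laplace transform of the symmetric beta density `u ^ (a - 1) (1 - u) ^ (a - 1)` on
`(0, 1]`, without normalisation. -/
noncomputable def betaLaplace (a : ℂ) (x : ℝ) : ℂ :=
  ∫ u in Ioc (0 : ℝ) 1,
    Complex.exp (-(u * x)) * ((u : ℂ) ^ (a - 1) * (1 - (u : ℂ)) ^ (a - 1))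

theorem integrableOn_beta {a b : ℂ} (ha : 0 < a.re) (hb : 0 < b.re) :
    IntegrableOn (fun u : ℝ => (u : ℂ) ^ (a - 1) * (1 - (u : ℂ)) ^ (b - 1)) (Ioc 0 1) :=
  (intervalIntegrable_iff_integrableOn_Ioc_of_le zero_le_one).1
    (Complex.betaIntegral_convergent ha hb)

theorem setIntegral_beta (a b : ℂ) :
    ∫ u in Ioc (0 : ℝ) 1, (u : ℂ) ^ (a - 1) * (1 - (u : ℂ)) ^ (b - 1) =
      Complex.betaIntegral a b := by
  rw [Complex.betaIntegral, intervalIntegral.integral_of_le zero_le_one]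

theorem continuousOn_betaLaplace {a : ℂ} (ha : 0 < a.re) :
    ContinuousOn (betaLaplace a) (Ioi 0) := by
  intro x hx
  refine ContinuousAt.continuousWithinAt ?_
  refine continuousAt_of_dominated (bound := fun u : ℝ =>
    ‖(u : ℂ) ^ (a - 1) * (1 - (u : ℂ)) ^ (a - 1)‖) ?_ ?_ (integrableOn_beta ha ha).norm ?_
  · refine Filter.Eventually.of_forall fun y => ?_
    have : Measurable fun u : ℝ =>
      Complex.exp (-(u * y)) * ((u : ℂ) ^ (a - 1) * (1 - (u : ℂ)) ^ (a - 1)) := by fun_prop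
    exact this.aestronglyMeasurable
  · filter_upwards [Ioi_mem_nhds hx] with y hy
    filter_upwards [ae_restrict_mem measurableSet_Ioc] with u hu
    rw [norm_mul]
    refine mul_le_of_le_one_left (norm_nonneg _) ?_
    rw [Complex.norm_exp, Real.exp_le_one_iff]
    simpa using mul_nonneg hu.1.le (le_of_lt hy)
  · refine Filter.Eventually.of_forall fun u => ?_
    fun_prop

theorem mellin_betaLaplace {a s : ℂ} (ha : 0 < a.re) (hs : 0 < s.re) (hsa : s.re < a.re) :
    MellinConvergent (betaLaplace a) s ∧
      mellin (betaLaplace a) s = Complex.Gamma s * Complex.betaIntegral (a - s) a := by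
  have heq : ∀ u ∈ Ioc (0 : ℝ) 1, (u : ℂ) ^ (a - s - 1) * (1 - (u : ℂ)) ^ (a - 1) =
      (u : ℂ) ^ (-s) * ((u : ℂ) ^ (a - 1) * (1 - (u : ℂ)) ^ (a - 1)) := by
    intro u hu
    have hu0 : (u : ℂ) ≠ 0 := Complex.ofReal_ne_zero.2 hu.1.ne'
    rw [← mul_assoc, ← Complex.cpow_add _ _ hu0]
    ring_nf
  have hint := (integrableOn_beta (a := a - s) (b := a) (by simpa using hsa) ha).congr_fun heq
    measurableSet_Ioc
  have h := mellin_laplace hs (integrableOn_beta ha ha).aestronglyMeasurable hint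
  refine ⟨h.1, h.2.trans ?_⟩
  rw [← setIntegral_congr_fun measurableSet_Ioc heq, setIntegral_beta]

/-! ### Centred moments of the beta density and the Bessel series -/

theorem cpow_add_one_sub_one {a : ℂ} (ha : a ≠ 0) (w : ℂ) : w ^ (a + 1 - 1) = w ^ (a - 1) * w := by
  rcases eq_or_ne w 0 with rfl | hw
  · simp [ha]
  · rw [show a + 1 - 1 = a - 1 + 1 by ring, Complex.cpow_add _ _ hw, Complex.cpow_one]

theorem norm_centered_pow_le_one {u : ℝ} (hu : u ∈ Ioc (0 : ℝ) 1) (n : ℕ) :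
    ‖(1 / 2 - (u : ℂ)) ^ n‖ ≤ 1 := by
  rw [norm_pow]
  refine pow_le_one₀ (norm_nonneg _) ?_
  rw [show (1 / 2 - (u : ℂ)) = ((1 / 2 - u : ℝ) : ℂ) by push_cast; rfl, Complex.norm_real,
    Real.norm_eq_abs, abs_le]
  constructor <;> linarith [hu.1, hu.2]

theorem integrableOn_beta_mul_centered_pow {a : ℂ} (ha : 0 < a.re) (n : ℕ) :
    IntegrableOn (fun u : ℝ =>
      (u : ℂ) ^ (a - 1) * (1 - (u : ℂ)) ^ (a - 1) * (1 / 2 - (u : ℂ)) ^ n) (Ioc 0 1) := by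
  refine (integrableOn_beta ha ha).mul_bdd (c := 1) ?_ ?_
  · exact (by fun_prop : Measurable fun u : ℝ => (1 / 2 - (u : ℂ)) ^ n).aestronglyMeasurable
  · filter_upwards [ae_restrict_mem measurableSet_Ioc] with u hu
    exact norm_centered_pow_le_one hu n

theorem setIntegral_beta_mul_centered_pow_odd (a : ℂ) {n : ℕ} (hn : Odd n) :
    ∫ u in Ioc (0 : ℝ) 1,
      (u : ℂ) ^ (a - 1) * (1 - (u : ℂ)) ^ (a - 1) * (1 / 2 - (u : ℂ)) ^ n = 0 := by
  rw [← intervalIntegral.integral_of_le zero_le_one]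
  have h := intervalIntegral.integral_comp_sub_left (a := 0) (b := 1) (fun u : ℝ =>
    (u : ℂ) ^ (a - 1) * (1 - (u : ℂ)) ^ (a - 1) * (1 / 2 - (u : ℂ)) ^ n) 1
  rw [sub_self, sub_zero] at h
  refine self_eq_neg.1 (h.symm.trans ?_)
  rw [← intervalIntegral.integral_neg]
  congr 1
  ext u
  push_cast
  rw [show (1 / 2 - (1 - (u : ℂ))) = -(1 / 2 - (u : ℂ)) by ring, hn.neg_pow, sub_sub_cancel]
  ring

/-- The even centred moments of the beta density. Since `(1 / 2 - u) ^ 2 = 1 / 4 - u (1 - u)`, the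
`(k + 1)`-st moment is a quarter of the `k`-th one minus the `k`-th one for `a + 1`; the moment for
`k = 0` is `B(a, a)`, evaluated by Legendre's duplication formula. -/
theorem setIntegral_beta_mul_centered_pow_even {a : ℂ} (ha : 0 < a.re) (k : ℕ) :
    ∫ u in Ioc (0 : ℝ) 1,
      (u : ℂ) ^ (a - 1) * (1 - (u : ℂ)) ^ (a - 1) * (1 / 2 - (u : ℂ)) ^ (2 * k) =
    2 ^ (1 - 2 * a) * (Real.sqrt Real.pi : ℂ) * (2 * k).factorial / (16 ^ k * k.factorial) *
      (Complex.Gamma a / Complex.Gamma (a + k + 1 / 2)) := by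
  induction k generalizing a with
  | zero =>
    have h1 : Complex.Gamma (a + 1 / 2) ≠ 0 :=
      Complex.Gamma_ne_zero_of_re_pos (by simp; positivity)
    have h2 : Complex.Gamma (a + a) ≠ 0 :=
      Complex.Gamma_ne_zero_of_re_pos (by simp; positivity)
    have hdup := Complex.Gamma_mul_Gamma_add_half a
    rw [two_mul a] at hdup
    simp only [mul_zero, pow_zero, mul_one, Nat.factorial_zero, Nat.cast_one, Nat.cast_zero,
      add_zero, div_one]
    rw [setIntegral_beta, Complex.betaIntegral_eq_Gamma_mul_div _ _ ha ha, two_mul a]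
    generalize Complex.Gamma (a + 1 / 2) = G at *
    generalize Complex.Gamma (a + a) = H at *
    generalize (2 : ℂ) ^ (1 - (a + a)) = P at *
    field_simp
    linear_combination Complex.Gamma a * hdup
  | succ k ih =>
    have ha0 : a ≠ 0 := by rintro rfl; simp at ha
    have ha1 : 0 < (a + 1).re := by simp; linarith
    have hb : a + k + 1 / 2 ≠ 0 := by
      intro h
      have := congrArg Complex.re h
      simp at this
      have : (0 : ℝ) ≤ k := k.cast_nonneg
      linarith
    have hG : Complex.Gamma (a + k + 1 / 2) ≠ 0 :=
      Complex.Gamma_ne_zero_of_re_pos (by simp; positivity)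
    have e1 : Complex.Gamma (a + 1 + k + 1 / 2) =
        (a + k + 1 / 2) * Complex.Gamma (a + k + 1 / 2) := by
      rw [← Complex.Gamma_add_one _ hb]; ring_nf
    have e2 : Complex.Gamma (a + (k + 1 : ℕ) + 1 / 2) =
        (a + k + 1 / 2) * Complex.Gamma (a + k + 1 / 2) := by
      rw [← Complex.Gamma_add_one _ hb]; push_cast; ring_nf
    have e3 : (2 : ℂ) ^ (1 - 2 * (a + 1)) = 2 ^ (1 - 2 * a) / 4 := by
      rw [show 1 - 2 * (a + 1) = 1 - 2 * a - (2 : ℕ) by push_cast; ring,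
        Complex.cpow_sub _ _ two_ne_zero, Complex.cpow_natCast]
      norm_num
    have e4 : ((2 * (k + 1)).factorial : ℂ) = (2 * k + 2) * (2 * k + 1) * (2 * k).factorial := by
      rw [show 2 * (k + 1) = 2 * k + 1 + 1 by ring, Nat.factorial_succ, Nat.factorial_succ]
      push_cast; ring
    have e5 : ((k + 1).factorial : ℂ) = (k + 1) * k.factorial := by
      rw [Nat.factorial_succ]; push_cast; ring
    have hsplit : ∀ u : ℝ,
        (u : ℂ) ^ (a - 1) * (1 - (u : ℂ)) ^ (a - 1) * (1 / 2 - (u : ℂ)) ^ (2 * (k + 1)) =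
        1 / 4 * ((u : ℂ) ^ (a - 1) * (1 - (u : ℂ)) ^ (a - 1) * (1 / 2 - (u : ℂ)) ^ (2 * k)) -
        (u : ℂ) ^ (a + 1 - 1) * (1 - (u : ℂ)) ^ (a + 1 - 1) * (1 / 2 - (u : ℂ)) ^ (2 * k) := by
      intro u
      rw [cpow_add_one_sub_one ha0, cpow_add_one_sub_one ha0]
      ring
    simp only [hsplit]
    rw [integral_sub ((integrableOn_beta_mul_centered_pow ha _).const_mul _)
      (integrableOn_beta_mul_centered_pow ha1 _), integral_const_mul, ih ha, ih ha1, e1, e2, e3, e4,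
      e5, Complex.Gamma_add_one _ ha0]
    have hk : (k.factorial : ℂ) ≠ 0 := Nat.cast_ne_zero.2 k.factorial_ne_zero
    have hk1 : (k : ℂ) + 1 ≠ 0 := Nat.cast_add_one_ne_zero k
    generalize Complex.Gamma (a + k + 1 / 2) = G at *
    generalize hd : a + (k : ℂ) + 1 / 2 = d at *
    field_simp
    linear_combination
      -((2 * k).factorial * Complex.Gamma a * 16 ^ k * 16) * hd

/-- Termwise integration of `e ^ (-u x) = e ^ (-x / 2) ∑ (x (1 / 2 - u)) ^ n / n!`. -/
theorem hasSum_betaLaplace {a : ℂ} (ha : 0 < a.re) (x : ℝ) :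
    HasSum (fun n : ℕ => Complex.exp (-x / 2) * ((x : ℂ) ^ n / n.factorial) *
      ∫ u in Ioc (0 : ℝ) 1,
        (u : ℂ) ^ (a - 1) * (1 - (u : ℂ)) ^ (a - 1) * (1 / 2 - (u : ℂ)) ^ n)
      (betaLaplace a x) := by
  have hint := integrableOn_beta ha ha
  simp only [← integral_const_mul, betaLaplace]
  refine hasSum_integral_of_dominated_convergence (fun n u => ‖Complex.exp (-x / 2)‖ *
    ‖(u : ℂ) ^ (a - 1) * (1 - (u : ℂ)) ^ (a - 1)‖ * (|x| ^ n / n.factorial)) ?_ ?_ ?_ ?_ ?_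
  · intro n
    exact (by fun_prop : Measurable fun u : ℝ =>
      Complex.exp (-x / 2) * ((x : ℂ) ^ n / n.factorial) *
        ((u : ℂ) ^ (a - 1) * (1 - (u : ℂ)) ^ (a - 1) *
          (1 / 2 - (u : ℂ)) ^ n)).aestronglyMeasurable
  · intro n
    filter_upwards [ae_restrict_mem measurableSet_Ioc] with u hu
    have h := norm_centered_pow_le_one hu n
    have hx : ‖(x : ℂ) ^ n / n.factorial‖ = |x| ^ n / n.factorial := by simp
    rw [norm_mul, norm_mul, norm_mul _ ((1 / 2 - (u : ℂ)) ^ n), hx]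
    calc _ = ‖Complex.exp (-x / 2)‖ * ‖(u : ℂ) ^ (a - 1) * (1 - (u : ℂ)) ^ (a - 1)‖ *
          (|x| ^ n / n.factorial) * ‖(1 / 2 - (u : ℂ)) ^ n‖ := by ring
      _ ≤ _ := mul_le_of_le_one_right (by positivity) h
  · exact Filter.Eventually.of_forall fun u => (Real.summable_pow_div_factorial |x|).mul_left _
  · simp only [tsum_mul_left]
    exact (hint.norm.const_mul _).mul_const _
  · refine Filter.Eventually.of_forall fun u => ?_
    have h := (NormedSpace.expSeries_div_hasSum_exp ((x : ℂ) * (1 / 2 - u))).mul_left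
      (Complex.exp (-x / 2) * ((u : ℂ) ^ (a - 1) * (1 - (u : ℂ)) ^ (a - 1)))
    rw [← Complex.exp_eq_exp_ℂ] at h
    convert! h using 1
    · ext n; rw [mul_pow]; ring
    · rw [show -((u : ℂ) * x) = -x / 2 + x * (1 / 2 - u) by ring, Complex.exp_add]; ring

/-- Poisson's integral for `I_ν`, in the variable `u = (1 + t) / 2` instead of `t ∈ [-1, 1]`. -/
theorem cpow_mul_betaLaplace {ν : ℂ} (hν : -(1 / 2) < ν.re) {x : ℝ} (hx : 0 < x) :
    (x : ℂ) ^ ν * betaLaplace (1 / 2 + ν) x =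
      (Real.sqrt Real.pi : ℂ) * Complex.Gamma (1 / 2 + ν) *
        (Complex.exp (-x / 2) * besselI ν (x / 2)) := by
  have ha : 0 < (1 / 2 + ν).re := by simp; linarith
  have h := hasSum_betaLaplace ha x
  -- The odd moments vanish by the symmetry `u ↦ 1 - u`, so only the even indices contribute.
  rw [← (mul_right_injective₀ (two_ne_zero' ℕ)).hasSum_iff] at h
  swap
  · intro n hn
    have : Odd n := by
      rw [← Nat.not_even_iff_odd, even_iff_exists_two_mul]
      rintro ⟨m, rfl⟩
      exact hn ⟨m, rfl⟩
    rw [setIntegral_beta_mul_centered_pow_odd _ this, mul_zero]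
  rw [← h.tsum_eq, besselI, ← tsum_mul_left, ← tsum_mul_left, ← tsum_mul_left]
  congr 1
  ext k
  simp only [Function.comp_apply]
  rw [setIntegral_beta_mul_centered_pow_even ha]
  have hx0 : (x : ℂ) ≠ 0 := Complex.ofReal_ne_zero.2 hx.ne'
  have hquarter : ((x : ℂ) / 4) ^ ν = (x : ℂ) ^ ν * 2 ^ (-(2 * ν)) := by
    have h2 : ((1 / 2 : ℝ) : ℂ) ^ ν = 2 ^ (-ν) := by
      rw [Complex.cpow_neg, ← Complex.inv_cpow _ _ (by
        rw [← Complex.ofReal_ofNat, Complex.arg_ofReal_of_nonneg zero_le_two]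
        exact Real.pi_pos.ne)]
      norm_num
    rw [show (x : ℂ) / 4 = x * ((1 / 2 : ℝ) : ℂ) * ((1 / 2 : ℝ) : ℂ) by push_cast; ring,
      ← Complex.ofReal_mul, Complex.mul_cpow_ofReal_nonneg (by positivity) (by positivity),
      Complex.ofReal_mul, Complex.mul_cpow_ofReal_nonneg hx.le (by positivity), h2, mul_assoc,
      ← Complex.cpow_add _ _ two_ne_zero]
    ring_nf
  have h4 : ((x : ℂ) / 2 / 2) ^ (2 * (k : ℂ) + ν) =
      (x : ℂ) ^ (2 * k) / 16 ^ k * ((x : ℂ) ^ ν * 2 ^ (-(2 * ν))) := by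
    rw [show (x : ℂ) / 2 / 2 = x / 4 by ring, Complex.cpow_add _ _ (by simpa using hx0), hquarter,
      show (2 * (k : ℂ)) = ((2 * k : ℕ) : ℂ) by push_cast; rfl, Complex.cpow_natCast, div_pow,
      pow_mul 4]
    norm_num
  rw [h4, show 1 - 2 * (1 / 2 + ν) = -(2 * ν) by ring,
    show 1 / 2 + ν + k + 1 / 2 = k + ν + 1 by ring]
  have hk : (k.factorial : ℂ) ≠ 0 := Nat.cast_ne_zero.2 k.factorial_ne_zero
  have hk2 : ((2 * k).factorial : ℂ) ≠ 0 := Nat.cast_ne_zero.2 (2 * k).factorial_ne_zero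
  field_simp

/-! ### Integrability of the Mellin transform on vertical lines -/

theorem norm_Gamma_le {s : ℂ} (hs : 0 < s.re) : ‖Complex.Gamma s‖ ≤ Real.Gamma s.re := by
  rw [Complex.Gamma_eq_integral hs, Real.Gamma_eq_integral hs, Complex.GammaIntegral]
  refine (norm_integral_le_integral_norm _).trans_eq ?_
  refine setIntegral_congr_fun measurableSet_Ioi fun x hx => ?_
  rw [norm_mul, Complex.norm_cpow_eq_rpow_re_of_pos hx, Complex.norm_real, Real.norm_eq_abs,
    Real.abs_exp]
  simp

/-- Quadratic decay of `Γ` on vertical lines, from `Γ(s + 2) = (s + 1) s Γ(s)`. -/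
theorem norm_Gamma_le_div_normSq {s : ℂ} (hs : 0 < s.re) :
    ‖Complex.Gamma s‖ ≤ Real.Gamma (s.re + 2) / Complex.normSq s := by
  have h0 : s ≠ 0 := by rintro rfl; simp at hs
  have h1 : s + 1 ≠ 0 := by
    intro h
    have := congrArg Complex.re h
    simp at this
    linarith
  have h2 : Complex.Gamma (s + 2) = (s + 1) * (s * Complex.Gamma s) := by
    rw [← Complex.Gamma_add_one s h0, ← Complex.Gamma_add_one _ h1]; ring_nf
  have h3 := norm_Gamma_le (s := s + 2) (by simp; linarith)
  rw [h2, norm_mul, norm_mul] at h3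
  have h4 : ‖s‖ ≤ ‖s + 1‖ := by
    refine le_of_sq_le_sq ?_ (norm_nonneg _)
    rw [Complex.sq_norm, Complex.sq_norm, Complex.normSq_apply, Complex.normSq_apply]
    simp
    nlinarith
  rw [le_div_iff₀ (Complex.normSq_pos.2 h0), Complex.normSq_eq_norm_sq]
  calc ‖Complex.Gamma s‖ * ‖s‖ ^ 2 = ‖s‖ * (‖s‖ * ‖Complex.Gamma s‖) := by ring
    _ ≤ ‖s + 1‖ * (‖s‖ * ‖Complex.Gamma s‖) := by gcongr
    _ ≤ _ := by simpa using h3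

theorem continuous_Gamma_comp {f : ℝ → ℂ} (hf : Continuous f) (hpos : ∀ y, 0 < (f y).re) :
    Continuous fun y => Complex.Gamma (f y) := by
  refine continuous_iff_continuousAt.2 fun y => ?_
  refine ContinuousAt.comp (g := Complex.Gamma) ?_ hf.continuousAt
  refine (Complex.differentiableAt_Gamma _ fun m h => ?_).continuousAt
  have := hpos y
  rw [h] at this
  simp at this
  linarith [(m.cast_nonneg : (0 : ℝ) ≤ m)]

theorem verticalIntegrable_Gamma {σ : ℝ} (hσ : 0 < σ) :
    Complex.VerticalIntegrable Complex.Gamma σ := by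
  have hre : ∀ y : ℝ, ((σ : ℂ) + y * Complex.I).re = σ := by simp
  refine Integrable.mono' (integrable_inv_one_add_sq.const_mul
    (Real.Gamma (σ + 2) * (min 1 (σ ^ 2))⁻¹)) ?_ (Filter.Eventually.of_forall fun y => ?_)
  · exact (continuous_Gamma_comp (by fun_prop)
      fun y => by rw [hre]; exact hσ).aestronglyMeasurable
  · refine (norm_Gamma_le_div_normSq (by rw [hre]; exact hσ)).trans ?_
    rw [hre, mul_assoc, ← mul_inv, ← div_eq_mul_inv, Complex.normSq_apply]
    have hm : 0 < min 1 (σ ^ 2) := lt_min one_pos (by positivity)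
    have hG : 0 ≤ Real.Gamma (σ + 2) := (Real.Gamma_pos_of_pos (by linarith)).le
    refine div_le_div_of_nonneg_left hG (by positivity) ?_
    simp only [Complex.add_re, Complex.add_im, Complex.mul_re, Complex.mul_im, Complex.ofReal_re,
      Complex.ofReal_im, Complex.I_re, Complex.I_im, mul_zero, mul_one, zero_add, add_zero,
      sub_zero]
    nlinarith [min_le_left 1 (σ ^ 2), min_le_right 1 (σ ^ 2), sq_nonneg y]


/-- The Mellin transform `Γ(s + ν) Γ(1/2 - s) / Γ(1 - s + ν)` of `√π e ^ (-x / 2) I_ν(x / 2)`, valid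
for `-Re ν < Re s < 1 / 2`. The quotient of the last two factors is a multiple of a beta
integral. -/
noncomputable def besselMellin (ν s : ℂ) : ℂ :=
  Complex.Gamma (s + ν) * (Complex.Gamma (1 / 2 - s) / Complex.Gamma (1 - s + ν))

theorem besselMellin_eq_betaIntegral {ν s : ℂ} (hν : -(1 / 2) < ν.re) (hs : s.re < 1 / 2) :
    Complex.Gamma (s + ν) * Complex.betaIntegral (1 / 2 - s) (1 / 2 + ν) =
      Complex.Gamma (1 / 2 + ν) * besselMellin ν s := by
  rw [Complex.betaIntegral_eq_Gamma_mul_div _ _ (by simp; linarith) (by simp; linarith),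
    besselMellin, show 1 / 2 - s + (1 / 2 + ν) = 1 - s + ν by ring]
  ring

theorem verticalIntegrable_besselMellin {ν : ℂ} {γ : ℝ} (hγν : 0 < γ + ν.re)
    (hγ : γ < 1 / 2) :
    Complex.VerticalIntegrable (besselMellin ν) γ := by
  have ha : 0 < (1 / 2 + ν).re := by simp; linarith
  have hG : Complex.Gamma (1 / 2 + ν) ≠ 0 := Complex.Gamma_ne_zero_of_re_pos ha
  have h1 : Integrable fun y : ℝ => Complex.Gamma (γ + y * Complex.I + ν) := by
    refine ((verticalIntegrable_Gamma hγν).comp_add_right ν.im).congr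
      (Filter.Eventually.of_forall fun y => ?_)
    simp only
    congr 1
    apply Complex.ext <;> simp
  have hcont : Continuous fun y : ℝ => Complex.Gamma (1 / 2 - (γ + y * Complex.I)) /
      Complex.Gamma (1 - (γ + y * Complex.I) + ν) := by
    simp only [div_eq_mul_inv]
    refine (continuous_Gamma_comp (by fun_prop) fun y => ?_).mul
      (Complex.differentiable_one_div_Gamma.continuous.comp (by fun_prop))
    simp; linarith
  -- Apart from a constant, the second factor is `B(1/2 - s, 1/2 + ν)`, whose integrand has a modulus
  -- depending only on `Re s = γ`.
  refine h1.mul_bdd (c := (∫ u in Ioc (0 : ℝ) 1,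
    ‖(u : ℂ) ^ (((1 / 2 - γ : ℝ) : ℂ) - 1) * (1 - (u : ℂ)) ^ (1 / 2 + ν - 1)‖) /
      ‖Complex.Gamma (1 / 2 + ν)‖) hcont.aestronglyMeasurable
    (Filter.Eventually.of_forall fun y => ?_)
  rw [le_div_iff₀ (norm_pos_iff.2 hG), ← norm_mul, div_mul_eq_mul_div,
    show 1 - ((γ : ℂ) + y * Complex.I) + ν = 1 / 2 - (γ + y * Complex.I) + (1 / 2 + ν) by ring,
    ← Complex.betaIntegral_eq_Gamma_mul_div _ _ (by simp; linarith) ha, ← setIntegral_beta]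
  refine (norm_integral_le_integral_norm _).trans_eq ?_
  refine setIntegral_congr_fun measurableSet_Ioc fun u hu => ?_
  rw [norm_mul, norm_mul, Complex.norm_cpow_eq_rpow_re_of_pos hu.1,
    Complex.norm_cpow_eq_rpow_re_of_pos hu.1]
  simp

/-! ### Mellin inversion -/

/-- Mellin inversion for `√π e ^ (-x / 2) I_ν(x / 2)`, together with the absolute convergence of the
inversion integral. -/
theorem integrable_and_integral_besselMellin {ν : ℂ} {γ x : ℝ} (hγν : 0 < γ + ν.re)
    (hγ : γ < 1 / 2) (hx : 0 < x) :
    Complex.VerticalIntegrable (fun s => (x : ℂ) ^ (-s) * besselMellin ν s) γ ∧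
      1 / (2 * (Real.pi : ℂ)) *
        ∫ y : ℝ, (x : ℂ) ^ (-(γ + y * Complex.I)) * besselMellin ν (γ + y * Complex.I) =
      (Real.sqrt Real.pi : ℂ) * (Complex.exp (-x / 2) * besselI ν (x / 2)) := by
  have hν : -(1 / 2) < ν.re := by linarith
  have ha : 0 < (1 / 2 + ν).re := by simp; linarith
  have hG : Complex.Gamma (1 / 2 + ν) ≠ 0 := Complex.Gamma_ne_zero_of_re_pos ha
  have hx0 : (x : ℂ) ≠ 0 := Complex.ofReal_ne_zero.2 hx.ne'
  have hint := verticalIntegrable_besselMellin hγν hγ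
  set f : ℝ → ℂ := fun t => (t : ℂ) ^ ν • betaLaplace (1 / 2 + ν) t with hf
  have hmellin : ∀ y : ℝ, MellinConvergent f (γ + y * Complex.I) ∧ mellin f (γ + y * Complex.I) =
      Complex.Gamma (1 / 2 + ν) * besselMellin ν (γ + y * Complex.I) := by
    intro y
    have h := mellin_betaLaplace (a := 1 / 2 + ν) (s := γ + y * Complex.I + ν) ha
      (by simpa using hγν) (by simpa using hγ)
    rw [hf, MellinConvergent.cpow_smul, mellin_cpow_smul, h.2,
      ← besselMellin_eq_betaIntegral hν (by simpa using hγ)]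
    refine ⟨h.1, ?_⟩
    rw [show 1 / 2 + ν - (γ + y * Complex.I + ν) = 1 / 2 - (γ + y * Complex.I) by ring]
  have hinv := mellinInv_mellin_eq γ f hx (by simpa using (hmellin 0).1)
    ((hint.const_mul (Complex.Gamma (1 / 2 + ν))).congr
      (Filter.Eventually.of_forall fun y => (hmellin y).2.symm))
    (ContinuousAt.smul
      (Complex.continuousAt_ofReal_cpow_const x ν (Or.inr hx.ne'))
      ((continuousOn_betaLaplace ha).continuousAt (Ioi_mem_nhds hx)))
  constructor
  · refine hint.bdd_mul (c := x ^ (-γ)) ?_ (Filter.Eventually.of_forall fun y => ?_)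
    · exact (Continuous.const_cpow (by fun_prop) (Or.inl hx0)).aestronglyMeasurable
    · rw [Complex.norm_cpow_eq_rpow_re_of_pos hx]
      simp
  · have hrep : f x = _ := cpow_mul_betaLaplace hν hx
    rw [hrep, mellinInv] at hinv
    simp only [(hmellin _).2, smul_eq_mul, Complex.real_smul] at hinv
    simp only [mul_left_comm _ (Complex.Gamma (1 / 2 + ν)), integral_const_mul] at hinv
    refine mul_left_cancel₀ hG (Eq.trans ?_ (hinv.trans ?_))
    · push_cast; ring
    · ring

/-! ### The real part of the Bessel function -/

theorem besselI_conj (ν : ℂ) {x : ℝ} (hx : 0 ≤ x) :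
    besselI (starRingEnd ℂ ν) x = starRingEnd ℂ (besselI ν x) := by
  rw [besselI, besselI, Complex.conj_tsum]
  congr 1
  ext k
  have harg : ((x : ℂ) / 2).arg ≠ Real.pi := by
    rw [show (x : ℂ) / 2 = ((x / 2 : ℝ) : ℂ) by push_cast; rfl,
      Complex.arg_ofReal_of_nonneg (by positivity)]
    exact Real.pi_pos.ne
  have hpow := Complex.cpow_conj ((x : ℂ) / 2) (2 * k + ν) harg
  have hGamma := Complex.Gamma_conj (k + ν + 1)
  simp only [map_add, map_mul, map_div₀, map_one, Complex.conj_natCast, Complex.conj_ofNat,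
    Complex.conj_ofReal] at hpow hGamma ⊢
  rw [hpow, hGamma]

theorem inv_Gamma_one_sub {w : ℂ} (hw : Complex.Gamma w ≠ 0) :
    (Complex.Gamma (1 - w))⁻¹ = Complex.Gamma w * (Complex.sin (Real.pi * w) / Real.pi) := by
  rw [← inv_div, ← Complex.Gamma_mul_Gamma_one_sub, mul_inv, mul_inv_cancel_left₀ hw]

/-- By the reflection formula the two Mellin transforms carry the factors `sin π(s - ν)` and
`sin π(s + ν)`, whose sum is `2 sin(πs) cos(πν)`. -/
theorem cos_mul_Gamma_quotient {ν s : ℂ} (h₁ : Complex.Gamma (s + ν) ≠ 0)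
    (h₂ : Complex.Gamma (s - ν) ≠ 0) :
    Complex.cos (Real.pi * ν) * (Complex.Gamma (s + ν) * Complex.Gamma (s - ν) *
      Complex.Gamma (1 / 2 - s) / (Complex.Gamma s * Complex.Gamma (1 - s))) =
      (besselMellin ν s + besselMellin (-ν) s) / 2 := by
  rw [besselMellin, besselMellin, show 1 - s + ν = 1 - (s - ν) by ring,
    show 1 - s + -ν = 1 - (s + ν) by ring, ← sub_eq_add_neg, div_eq_mul_inv _ (Complex.Gamma _),
    div_eq_mul_inv _ (Complex.Gamma (1 - (s + ν))), inv_Gamma_one_sub h₁, inv_Gamma_one_sub h₂,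
    Complex.Gamma_mul_Gamma_one_sub, mul_sub, mul_add, Complex.sin_add, Complex.sin_sub,
    div_div_eq_mul_div]
  ring

theorem lemma1 (x : ℝ) (hx : 0 < x) (τ : ℝ) (γ : ℝ) (hγ0 : 0 < γ) (hγ1 : γ < 1 / 2) :
    Complex.VerticalIntegrable (mellinBarnesIntegrand τ x) γ ∧
      (lebedevSkalskayaKernel τ x : ℂ) =
        1 / (2 * (Real.pi : ℂ) * Complex.I) *
          verticalLineIntegral (mellinBarnesIntegrand τ x) γ := by
  set ν : ℂ := Complex.I * τ with hν
  have hre : ν.re = 0 := by simp [hν]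
  have hcosh : (Real.cosh (Real.pi * τ) : ℂ) ≠ 0 :=
    Complex.ofReal_ne_zero.2 (Real.cosh_pos _).ne'
  have hcos : Complex.cos (Real.pi * ν) = Real.cosh (Real.pi * τ) := by
    rw [Complex.ofReal_cosh, ← Complex.cos_mul_I, hν]
    push_cast
    ring_nf
  obtain ⟨hint₁, hval₁⟩ := integrable_and_integral_besselMellin (ν := ν) (γ := γ) (x := x)
    (by rw [hre]; simpa using hγ0) hγ1 hx
  obtain ⟨hint₂, hval₂⟩ := integrable_and_integral_besselMellin (ν := -ν) (γ := γ) (x := x)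
    (by rw [Complex.neg_re, hre]; simpa using hγ0) hγ1 hx
  have hpt : ∀ y : ℝ, mellinBarnesIntegrand τ x (γ + y * Complex.I) =
      1 / (2 * Real.cosh (Real.pi * τ)) *
        ((x : ℂ) ^ (-(γ + y * Complex.I)) * besselMellin ν (γ + y * Complex.I) +
          (x : ℂ) ^ (-(γ + y * Complex.I)) * besselMellin (-ν) (γ + y * Complex.I)) := by
    intro y
    have h := cos_mul_Gamma_quotient (ν := ν) (s := γ + y * Complex.I)
      (Complex.Gamma_ne_zero_of_re_pos (by simpa [hre] using hγ0))
      (Complex.Gamma_ne_zero_of_re_pos (by simpa [hre] using hγ0))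
    rw [hcos] at h
    rw [mellinBarnesIntegrand, ← hν, ← mul_right_inj' hcosh, ← mul_assoc, h]
    field_simp
  refine ⟨((hint₁.add hint₂).const_mul _).congr
    (Filter.Eventually.of_forall fun y => (hpt y).symm), ?_⟩
  have hbessel : ((besselI ν (x / 2)).re : ℂ) = (besselI ν (x / 2) + besselI (-ν) (x / 2)) / 2 := by
    have hconj := besselI_conj ν (x := x / 2) (by positivity)
    rw [show starRingEnd ℂ ν = -ν by simp [hν]] at hconj
    push_cast at hconj
    rw [hconj, Complex.re_eq_add_conj]
  have hI : Complex.I ≠ 0 := Complex.I_ne_zero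
  have hpi : (Real.pi : ℂ) ≠ 0 := Complex.ofReal_ne_zero.2 Real.pi_ne_zero
  rw [verticalLineIntegral, integral_mul_const]
  simp only [hpt]
  rw [integral_const_mul, integral_add hint₁ hint₂, lebedevSkalskayaKernel]
  push_cast at hbessel hcosh hval₁ hval₂ ⊢
  rw [← hν, hbessel]
  generalize (∫ y : ℝ, (x : ℂ) ^ (-(γ + y * Complex.I)) *
    besselMellin ν (γ + y * Complex.I)) = J₁ at *
  generalize (∫ y : ℝ, (x : ℂ) ^ (-(γ + y * Complex.I)) *
    besselMellin (-ν) (γ + y * Complex.I)) = J₂ at *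
  trans 1 / (2 * Complex.cosh (Real.pi * τ)) *
    (1 / (2 * (Real.pi : ℂ)) * J₁ + 1 / (2 * (Real.pi : ℂ)) * J₂)
  · rw [hval₁, hval₂]
    ring
  · field_simp
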